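/- **Theorem 4.8.** Let $\mathcal H$ be a complex Hilbert space and let $G$ be a positive trace-class operator on $\mathcal H$; for example a trace-class frame operator $G=\sum_{\alpha\in A} w_\alpha |f_\alpha\rangle\langle f_\alpha|$ (pointwise convergent sum) with vectors $f_\alpha\in\mathcal H$ and weights $w_\alpha\ge 0$. Orthonormal bases (ONBs) $(\psi_i)_{i\in I}$ are indexed by well-ordered sets $I$ (usually $I=\mathbb N$), so that the first $n$ basis vectors make sense (all of them, if there are at most $n$). For an ONB $\psi$ let $Q_n^\psi$ be the orthogonal projection onto the span of its first $n$ vectors, and define the error terms $$E_n^\psi=\operatorname{tr}\bigl(G\,(I-Q_n^\psi)\bigr).$$ A Karhunen–Loève ONB for $G$ is an ONB $(\phi_i)_{i\in I}$ with $G\phi_i=\lambda_i\phi_i$ for real $\lambda_i$ satisfying $\lambda_i\ge\lambda_j$ whenever $i\le j$. Then: 1. A Karhunen–Loève ONB for $G$ exists. 2. For every Karhunen–Loève ONB $\phi$, every ONB $\psi$ and every $n$, $E_n^\phi\le E_n^\psi$. In particular the infimum of $E_n^\psi$ over all ONBs with the same index set as $\phi$ is attained at $\psi=\phi$, simultaneously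 for all $n$. 3. The trace defining $E_n^\psi$ converges unconditionally, with the same real value, in every ONB of $\mathcal H$. Whenever $G=\sum_{\alpha} w_\alpha|f_\alpha\rangle\langle f_\alpha|$ as above, it is the approximation error $$E_n^\psi=\sum_{\alpha\in A} w_\alpha\Bigl\|f_\alpha-\sum_{i\text{ among the first }n}\langle\psi_i| f_\alpha\rangle\,\psi_i\Bigr\|^2 .$$ -/

import Mathlib

open scoped InnerProductSpace

universe u v v₁ v₂ v₃ v₄

noncomputable section

namespace KarhunenLoeve

/-- In a linear order, only finitely many elements have fewer than `n` predecessors. -/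
theorem finite_setOf_encard_Iio_lt (ι : Type v) [LinearOrder ι] (n : ℕ) :
    {i : ι | (Set.Iio i).encard < (n : ℕ∞)}.Finite := by
  refine Set.Finite.of_injOn (f := fun i : ι => (Set.Iio i).encard)
    (t := Set.Iio (n : ℕ∞)) (fun i hi => hi) ?_ ?_
  · have key : ∀ i j : ι, (Set.Iio i).encard < (n : ℕ∞) → i < j →
        (Set.Iio i).encard < (Set.Iio j).encard := fun i j hi hij =>
      (Set.encard_lt_top_iff.1 (hi.trans (ENat.natCast_lt_top n))).encard_lt_encard
        (Set.Iio_ssubset_Iio hij)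
    intro i hi j hj hij
    rcases lt_trichotomy i j with h | h | h
    · exact absurd hij (key i j hi h).ne
    · exact h
    · exact absurd hij (key j i hj h).ne'
  · refine (Set.finite_range (fun k : Fin n => ((k : ℕ) : ℕ∞))).subset ?_
    intro x hx
    have hx' : x < (n : ℕ∞) := hx
    lift x to ℕ using (hx'.trans (ENat.natCast_lt_top n)).ne
    exact ⟨⟨x, by exact_mod_cast hx'⟩, rfl⟩

/-- The first `n` elements of a well-ordered index set `ι`: those with fewer than `n`
predecessors. For `ι = ℕ` this is `{0, …, n - 1}`; if `ι` has at most `n` elements, it is all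
of `ι`. -/
def firstIdx (ι : Type v) [LinearOrder ι] (n : ℕ) : Finset ι :=
  (finite_setOf_encard_Iio_lt ι n).toFinset

variable {H : Type u} [NormedAddCommGroup H] [InnerProductSpace ℂ H] [CompleteSpace H]

/-- `T` is trace class: `∑ᵢ ⟨bᵢ, |T| bᵢ⟩ < ∞` for some orthonormal basis `b`, where
`|T| = (T* T)^{1/2}`. (For positive `T` one has `|T| = T`.) -/
def IsTraceClass (T : H →L[ℂ] H) : Prop :=
  ∃ (s : Set H) (b : HilbertBasis s ℂ H), Summable fun i => ⟪b i, CFC.abs T (b i)⟫_ℂ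

variable (H) in
/-- Some orthonormal basis of `H`. -/
def someONB : HilbertBasis (exists_hilbertBasis ℂ H).choose ℂ H :=
  (exists_hilbertBasis ℂ H).choose_spec.choose

/-- The trace `∑ᵢ ⟨bᵢ, T bᵢ⟩`, computed in some orthonormal basis `b` of `H`. -/
def trace (T : H →L[ℂ] H) : ℂ :=
  ∑' i, ⟪someONB H i, T (someONB H i)⟫_ℂ

/-- `Q_n = ∑_{i ≤ n} |ψ_i⟩⟨ψ_i|`, the orthogonal projection onto the span of the first `n`
vectors of the orthonormal basis `ψ`. -/
def Q {ι : Type v} [LinearOrder ι] (ψ : HilbertBasis ι ℂ H) (n : ℕ) : H →L[ℂ] H :=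
  ∑ i ∈ firstIdx ι n, InnerProductSpace.rankOne ℂ (ψ i) (ψ i)

/-- The error term `E_n^ψ = tr (G Q_n^⊥)`, `Q_n^⊥ = I - Q_n`. -/
def errorTerm {ι : Type v} [LinearOrder ι] (G : H →L[ℂ] H) (ψ : HilbertBasis ι ℂ H) (n : ℕ) : ℝ :=
  (trace (G ∘L (ContinuousLinearMap.id ℂ H - Q ψ n))).re

/-- `φ` is a Karhunen–Loève orthonormal basis for `G`: an orthonormal basis of eigenvectors
whose eigenvalues are arranged in decreasing order. -/
def IsKarhunenLoeve {ι : Type v} [LinearOrder ι] (G : H →L[ℂ] H) (φ : HilbertBasis ι ℂ H) : Prop :=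
  ∃ lam : ι → ℝ, Antitone lam ∧ ∀ i, G (φ i) = (lam i : ℂ) • φ i

/-- `G = ∑_α w_α |f_α⟩⟨f_α|` with weights `w_α ≥ 0`, the sum converging pointwise on `H`. -/
def IsFrameOperator {A : Type v} (w : A → ℝ) (f : A → H) (G : H →L[ℂ] H) : Prop :=
  (∀ α, 0 ≤ w α) ∧
    ∀ x, HasSum (fun α => (w α : ℂ) • InnerProductSpace.rankOne ℂ (f α) (f α) x) (G x)

end KarhunenLoeve

end

/-! Write `G = S ∘L S` with `S` self-adjoint. Then `⟪b i, G (b i)⟫ = ‖S (b i)‖ ^ 2`, and Parseval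
with Tonelli makes the trace independent of the basis. The error term is `tr G` minus the sum of `⟪ψ
k, G (ψ k)⟫` over the first `n` vectors, so minimality means maximizing that sum. In an eigenbasis
`φ` it equals `∑ lam i * p i` with `p i = ∑ k, ‖⟪φ i, ψ k⟫‖ ^ 2`. Bessel gives `p i ≤ 1`, Parseval
gives total mass at most `n`, and such weights do best on the largest eigenvalues
(`hasSum_le_sum_firstIdx`).

For existence, `S` is Hilbert–Schmidt, so `G` is compact and has an eigenbasis. Summability of the
eigenvalues allows a decreasing well-order (`exists_wellOrder_antitone`). Its order type may exceed
that of `ℕ`, since the kernel may follow infinitely many positive eigenvalues. -/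

noncomputable section

namespace KarhunenLoeve

/-! ### Initial segments of the index set. -/

section Index

variable {ι : Type v} [LinearOrder ι] {n : ℕ}

theorem mem_firstIdx {i : ι} : i ∈ firstIdx ι n ↔ (Set.Iio i).encard < (n : ℕ∞) := by
  simp [firstIdx]

theorem lt_of_mem_firstIdx_of_notMem {i j : ι} (hi : i ∈ firstIdx ι n)
    (hj : j ∉ firstIdx ι n) : i < j := by
  by_contra! h
  exact hj (mem_firstIdx.2
    ((Set.encard_le_encard (Set.Iio_subset_Iio h)).trans_lt (mem_firstIdx.1 hi)))

theorem card_firstIdx_le : (firstIdx ι n).card ≤ n := by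
  rcases (firstIdx ι n).eq_empty_or_nonempty with h | h
  · simp [h]
  · set m := (firstIdx ι n).max' h
    have hsub : ((firstIdx ι n : Finset ι) : Set ι) ⊆ insert m (Set.Iio m) := fun i hi =>
      ((firstIdx ι n).le_max' i hi).eq_or_lt
    have h1 := Set.encard_le_encard hsub
    have h2 := h1.trans (Set.encard_insert_le _ _)
    have h3 := Order.add_one_le_of_lt (mem_firstIdx.1 ((firstIdx ι n).max'_mem h))
    rw [Set.encard_coe_eq_coe_finsetCard] at h2
    exact_mod_cast h2.trans h3

/-- Either the first `n` indices are all of them, or there are exactly `n` and a next one. -/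
theorem firstIdx_eq_univ_or [WellFoundedLT ι] :
    (∀ i, i ∈ firstIdx ι n) ∨
      (firstIdx ι n).card = n ∧ ∃ j, (∀ i ∈ firstIdx ι n, i < j) ∧
        ∀ i, i ∉ firstIdx ι n → j ≤ i := by
  by_cases h : ∀ i, i ∈ firstIdx ι n
  · exact Or.inl h
  · push Not at h
    obtain ⟨j, hj, hmin⟩ := wellFounded_lt.has_min {i | i ∉ firstIdx ι n} h
    refine Or.inr ⟨le_antisymm card_firstIdx_le ?_, j,
      fun i hi => lt_of_mem_firstIdx_of_notMem hi hj, fun i hi => not_lt.1 (hmin i hi)⟩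
    -- By minimality of `j` all its predecessors are selected; as `j` is not, there are at least `n`
    -- of them.
    have hsub : Set.Iio j ⊆ ((firstIdx ι n : Finset ι) : Set ι) := fun i hi => by
      by_contra hi'
      exact hmin i hi' hi
    have h1 := Set.encard_le_encard hsub
    rw [Set.encard_coe_eq_coe_finsetCard] at h1
    have h2 : (n : ℕ∞) ≤ (Set.Iio j).encard := not_lt.1 fun h => hj (mem_firstIdx.2 h)
    exact_mod_cast h2.trans h1

end Index

/-- Tonelli: by nonnegativity, summable row sums make the whole double family summable. -/
theorem hasSum_swap_of_nonneg {α : Type*} {β : Type*} {f : α → β → ℝ} (hf : ∀ a b, 0 ≤ f a b)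
    {r : α → ℝ} {s : β → ℝ} {t : ℝ} (hr : ∀ a, HasSum (f a) (r a))
    (hs : ∀ b, HasSum (fun a => f a b) (s b)) (ht : HasSum r t) : HasSum s t := by
  have h1 : Summable fun p : α × β => f p.1 p.2 := by
    rw [summable_prod_of_nonneg (fun p => hf p.1 p.2)]
    exact ⟨fun a => (hr a).summable, by simpa only [fun a => (hr a).tsum_eq] using ht.summable⟩
  obtain ⟨t', h2⟩ := h1
  obtain rfl := (h2.prod_fiberwise hr).unique ht
  exact ((Equiv.prodComm β α).hasSum_iff.2 h2).prod_fiberwise hs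

/-! ### Parseval and square sums. -/

section Hilbert

variable {H : Type u} [NormedAddCommGroup H] [InnerProductSpace ℂ H]

theorem norm_sub_sum_sq {ι : Type*} {v : ι → H} (hv : Orthonormal ℂ v) (F : Finset ι) (x : H) :
    ‖x - ∑ i ∈ F, ⟪v i, x⟫_ℂ • v i‖ ^ 2 = ‖x‖ ^ 2 - ∑ i ∈ F, ‖⟪v i, x⟫_ℂ‖ ^ 2 := by
  have h₂ : (∑ i ∈ F, ∑ j ∈ F, ⟪v i, x⟫_ℂ * ⟪x, v j⟫_ℂ * ⟪v j, v i⟫_ℂ) =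
      ∑ k ∈ F, ⟪v k, x⟫_ℂ * ⟪x, v k⟫_ℂ := hv.inner_left_right_finset
  have h₃ (z : ℂ) : RCLike.re (z * (starRingEnd ℂ) z) = ‖z‖ ^ 2 := by
    rw [RCLike.mul_conj]
    norm_cast
  rw [@norm_sub_sq ℂ, sub_add]
  simp only [@InnerProductSpace.norm_sq_eq_re_inner ℂ H, inner_sum, sum_inner]
  simp only [inner_smul_right, two_mul, inner_smul_left, inner_conj_symm, ← mul_assoc, h₂,
    add_sub_cancel_right, sub_right_inj]
  simp only [map_sum, ← inner_conj_symm x, ← h₃]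

theorem hasSum_norm_inner_sq {ι : Type*} (b : HilbertBasis ι ℂ H) (x : H) :
    HasSum (fun i => ‖⟪b i, x⟫_ℂ‖ ^ 2) (‖x‖ ^ 2) := by
  have h := b.hasSum_inner_mul_inner x x
  have h2 := Complex.hasSum_re h
  convert h2 using 1
  · ext i
    rw [← inner_conj_symm x, Complex.conj_mul']
    norm_cast
  · rw [inner_self_eq_norm_sq_to_K]; norm_cast

variable [CompleteSpace H]

/-- The square sum of a self-adjoint operator does not depend on the orthonormal basis. -/
theorem hasSum_norm_apply_sq {ι : Type*} {κ : Type*} {S : H →L[ℂ] H} (hS : IsSelfAdjoint S)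
    (b : HilbertBasis ι ℂ H) (c : HilbertBasis κ ℂ H) {t : ℝ}
    (h : HasSum (fun i => ‖S (b i)‖ ^ 2) t) : HasSum (fun j => ‖S (c j)‖ ^ 2) t := by
  refine hasSum_swap_of_nonneg (f := fun i j => ‖⟪c j, S (b i)⟫_ℂ‖ ^ 2) (fun _ _ => by positivity)
    (fun i => hasSum_norm_inner_sq c _) (fun j => ?_) h
  convert hasSum_norm_inner_sq b (S (c j)) using 2 with i
  rw [← hS.isSymmetric.apply_clm, norm_inner_symm]

end Hilbert

/-! ### Traces, error terms and Ky Fan's inequality. -/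

section Trace

variable {H : Type u} [NormedAddCommGroup H] [InnerProductSpace ℂ H] [CompleteSpace H]
  {G : H →L[ℂ] H}

theorem exists_isSelfAdjoint_comp_self_eq (hpos : G.IsPositive) :
    ∃ S : H →L[ℂ] H, IsSelfAdjoint S ∧ S ∘L S = G := by
  have h := (ContinuousLinearMap.nonneg_iff_isPositive G).2 hpos
  exact ⟨CFC.sqrt G, (CFC.sqrt_nonneg G).isSelfAdjoint, CFC.sqrt_mul_sqrt_self G h⟩

theorem inner_comp_self_apply {S : H →L[ℂ] H} (hS : IsSelfAdjoint S) (x : H) :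
    ⟪x, (S ∘L S) x⟫_ℂ = ((‖S x‖ ^ 2 : ℝ) : ℂ) := by
  rw [ContinuousLinearMap.comp_apply, ← hS.isSymmetric.apply_clm, inner_self_eq_norm_sq_to_K]
  norm_cast

/-- The trace of a positive trace-class operator converges in every orthonormal basis. -/
theorem hasSum_inner_apply_trace (hpos : G.IsPositive) (htr : IsTraceClass G) {J : Type*}
    (b : HilbertBasis J ℂ H) : HasSum (fun j => ⟪b j, G (b j)⟫_ℂ) (trace G) := by
  obtain ⟨s, c, hc⟩ := htr
  rw [CFC.abs_of_nonneg G ((ContinuousLinearMap.nonneg_iff_isPositive G).2 hpos)] at hc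
  obtain ⟨S, hS, rfl⟩ := exists_isSelfAdjoint_comp_self_eq hpos
  simp only [trace, inner_comp_self_apply hS] at hc ⊢
  obtain ⟨t, ht⟩ := Complex.summable_ofReal.1 hc
  rw [← Complex.ofReal_tsum, (hasSum_norm_apply_sq hS c (someONB H) ht).tsum_eq]
  exact Complex.hasSum_ofReal.2 (hasSum_norm_apply_sq hS c b ht)

theorem hasSum_re_inner_apply_trace (hpos : G.IsPositive) (htr : IsTraceClass G) {J : Type*}
    (b : HilbertBasis J ℂ H) : HasSum (fun j => (⟪b j, G (b j)⟫_ℂ).re) (trace G).re :=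
  Complex.hasSum_re (hasSum_inner_apply_trace hpos htr b)

theorem ofReal_re_inner_apply (hpos : G.IsPositive) (x : H) :
    ((⟪x, G x⟫_ℂ).re : ℂ) = ⟪x, G x⟫_ℂ := by
  obtain ⟨S, hS, rfl⟩ := exists_isSelfAdjoint_comp_self_eq hpos
  rw [inner_comp_self_apply hS, Complex.ofReal_re]

theorem ofReal_re_trace (hpos : G.IsPositive) : ((trace G).re : ℂ) = trace G := by
  have h : trace G = ((∑' i, (⟪someONB H i, G (someONB H i)⟫_ℂ).re : ℝ) : ℂ) := by
    rw [Complex.ofReal_tsum]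
    simp only [ofReal_re_inner_apply hpos, trace]
  rw [h, Complex.ofReal_re]

section ErrorTerm

variable {κ : Type v} [LinearOrder κ]

/-- `G ∘L Q ψ n` has finite rank, so Parseval in `b` evaluates its trace one `ψ i` at a time;
positivity of the product is not needed. -/
theorem hasSum_inner_comp_id_sub_Q (hpos : G.IsPositive) (htr : IsTraceClass G)
    (ψ : HilbertBasis κ ℂ H) (n : ℕ) {J : Type*} (b : HilbertBasis J ℂ H) :
    HasSum (fun j => ⟪b j, (G ∘L (ContinuousLinearMap.id ℂ H - Q ψ n)) (b j)⟫_ℂ)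
      (trace G - ∑ i ∈ firstIdx κ n, ⟪ψ i, G (ψ i)⟫_ℂ) := by
  refine ((hasSum_inner_apply_trace hpos htr b).sub (hasSum_sum (s := firstIdx κ n) fun i _ =>
    b.hasSum_inner_mul_inner (ψ i) (G (ψ i)))).congr_fun fun j => ?_
  simp [Q]

theorem errorTerm_eq (hpos : G.IsPositive) (htr : IsTraceClass G) (ψ : HilbertBasis κ ℂ H)
    (n : ℕ) : errorTerm G ψ n =
      (trace G).re - ∑ i ∈ firstIdx κ n, (⟪ψ i, G (ψ i)⟫_ℂ).re := by
  rw [errorTerm, trace, (hasSum_inner_comp_id_sub_Q hpos htr ψ n _).tsum_eq]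
  rw [Complex.sub_re, Complex.re_sum]

theorem hasSum_errorTerm (hpos : G.IsPositive) (htr : IsTraceClass G)
    (ψ : HilbertBasis κ ℂ H) (n : ℕ) {J : Type*} (b : HilbertBasis J ℂ H) :
    HasSum (fun j => ⟪b j, (G ∘L (ContinuousLinearMap.id ℂ H - Q ψ n)) (b j)⟫_ℂ)
      (errorTerm G ψ n : ℂ) := by
  convert hasSum_inner_comp_id_sub_Q hpos htr ψ n b
  rw [errorTerm_eq hpos htr]
  push_cast
  rw [ofReal_re_trace hpos, Finset.sum_congr rfl fun i _ => ofReal_re_inner_apply hpos (ψ i)]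

omit [CompleteSpace H] in
theorem IsFrameOperator.hasSum_inner {A : Type*} {w : A → ℝ} {f : A → H}
    (hf : IsFrameOperator w f G) (x : H) :
    HasSum (fun α => w α * ‖⟪x, f α⟫_ℂ‖ ^ 2) (⟪x, G x⟫_ℂ).re := by
  convert Complex.hasSum_re ((hf.2 x).mapL (innerSL ℂ x)) using 2 with α
  · rw [innerSL_apply_apply, inner_smul_right, InnerProductSpace.rankOne_apply, inner_smul_right,
    ← inner_conj_symm (f α) x, Complex.conj_mul']
    norm_cast
  · rw [innerSL_apply_apply]

theorem IsFrameOperator.hasSum_errorTerm (hpos : G.IsPositive) (htr : IsTraceClass G)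
    {A : Type*} {w : A → ℝ} {f : A → H} (hf : IsFrameOperator w f G)
    (ψ : HilbertBasis κ ℂ H) (n : ℕ) :
    HasSum (fun α => w α * ‖f α - ∑ i ∈ firstIdx κ n, ⟪ψ i, f α⟫_ℂ • ψ i‖ ^ 2)
      (errorTerm G ψ n) := by
  have h1 : HasSum (fun α => w α * ‖f α‖ ^ 2) (trace G).re :=
    hasSum_swap_of_nonneg (f := fun i α => w α * ‖⟪ψ i, f α⟫_ℂ‖ ^ 2)
      (fun _ α => mul_nonneg (hf.1 α) (sq_nonneg _)) (fun i => hf.hasSum_inner (ψ i))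
      (fun α => (hasSum_norm_inner_sq ψ (f α)).mul_left _)
      (hasSum_re_inner_apply_trace hpos htr ψ)
  rw [errorTerm_eq hpos htr]
  refine (h1.sub (hasSum_sum (s := firstIdx κ n) fun i _ => hf.hasSum_inner (ψ i))).congr_fun
    fun α => ?_
  rw [norm_sub_sum_sq ψ.orthonormal, mul_sub, Finset.mul_sum]

end ErrorTerm

/-- Ky Fan's inequality for weights: a sum with decreasing nonnegative values `lam`
and weights in `[0, 1]` of total mass at most `n` is at most the sum of the first `n` values. -/
theorem hasSum_le_sum_firstIdx {ι : Type*} [LinearOrder ι] [WellFoundedLT ι] {lam p : ι → ℝ}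
    (hanti : Antitone lam) (hlam : ∀ i, 0 ≤ lam i) (hp : ∀ i, 0 ≤ p i) (hp1 : ∀ i, p i ≤ 1)
    {n : ℕ} {a m : ℝ} (hm : m ≤ n) (hps : HasSum p m) (ha : HasSum (fun i => lam i * p i) a) :
    a ≤ ∑ i ∈ firstIdx ι n, lam i := by
  -- The threshold `μ` is the first value left out. If no index is left out, there may be fewer than
  -- `n` of them, and `μ = 0` makes the mass bound trivial.
  have key : ∃ μ : ℝ, (∀ i ∈ firstIdx ι n, μ ≤ lam i) ∧ (∀ i, i ∉ firstIdx ι n → lam i ≤ μ) ∧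
      μ * m ≤ μ * (firstIdx ι n).card := by
    rcases firstIdx_eq_univ_or (ι := ι) (n := n) with h | ⟨hc, j, hj, hj'⟩
    · exact ⟨0, fun i _ => hlam i, fun i hi => absurd (h i) hi, by simp⟩
    · exact ⟨lam j, fun i hi => hanti (hj i hi).le, fun i hi => hanti (hj' i hi),
        mul_le_mul_of_nonneg_left (hc.symm ▸ hm) (hlam j)⟩
  obtain ⟨μ, h1, h2, h3⟩ := key
  have h4 : HasSum (fun i => if i ∈ firstIdx ι n then lam i - μ else 0)
      (∑ i ∈ firstIdx ι n, lam i - μ * (firstIdx ι n).card) := by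
    convert hasSum_sum_of_ne_finset_zero (s := firstIdx ι n)
      (f := fun i => if i ∈ firstIdx ι n then lam i - μ else 0) (fun i hi => if_neg hi) using 1
    · rw [Finset.sum_congr rfl fun i hi => if_pos hi]
      simp [mul_comm]
    · infer_instance
  -- Termwise, `(lam i - μ) * p i` is at most `lam i - μ` on the first indices and at most `0`
  -- elsewhere.
  have h5 : a - μ * m ≤ _ := hasSum_le (fun i => ?_) (ha.sub (hps.mul_left μ)) h4
  · linarith
  · split_ifs with hi
    · nlinarith [h1 i hi, hp1 i]
    · nlinarith [h2 i hi, hp i]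

end Trace

/-! ### Comparison with an eigenbasis. -/

section Minimality

variable {H : Type u} [NormedAddCommGroup H] [InnerProductSpace ℂ H] [CompleteSpace H]
  {G : H →L[ℂ] H}

omit [CompleteSpace H] in
theorem re_inner_apply_of_eq_smul {x : H} {r : ℝ} (h : G x = (r : ℂ) • x) :
    (⟪x, G x⟫_ℂ).re = r * ‖x‖ ^ 2 := by
  rw [h, inner_smul_right, inner_self_eq_norm_sq_to_K]
  norm_cast
  exact Complex.re_ofReal_mul r _

theorem eigenvalue_nonneg {ι : Type*} (hpos : G.IsPositive) (φ : HilbertBasis ι ℂ H) {lam : ι → ℝ}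
    (h : ∀ i, G (φ i) = (lam i : ℂ) • φ i) (i : ι) : 0 ≤ lam i := by
  have h1 := hpos.re_inner_nonneg_right (φ i)
  have h2 := re_inner_apply_of_eq_smul (h i)
  rw [φ.orthonormal.1 i] at h2
  have h3 : (⟪φ i, G (φ i)⟫_ℂ).re = lam i := by simpa using h2
  exact h3 ▸ h1

theorem hasSum_eigenvalue_mul {ι : Type*} (hpos : G.IsPositive) (φ : HilbertBasis ι ℂ H)
    {lam : ι → ℝ} (h : ∀ i, G (φ i) = (lam i : ℂ) • φ i) (x : H) :
    HasSum (fun i => lam i * ‖⟪φ i, x⟫_ℂ‖ ^ 2) (⟪x, G x⟫_ℂ).re := by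
  refine (Complex.hasSum_re (φ.hasSum_inner_mul_inner x (G x))).congr_fun fun i => ?_
  rw [← hpos.isSelfAdjoint.isSymmetric.apply_clm, h, inner_smul_left, ← inner_conj_symm x,
    mul_left_comm, Complex.conj_mul', Complex.conj_ofReal]
  norm_cast

theorem errorTerm_le_errorTerm (hpos : G.IsPositive) (htr : IsTraceClass G)
    {ι : Type v₁} [LinearOrder ι] [WellFoundedLT ι] {φ : HilbertBasis ι ℂ H}
    (hφ : IsKarhunenLoeve G φ) {κ : Type v₂} [LinearOrder κ]
    (ψ : HilbertBasis κ ℂ H) (n : ℕ) : errorTerm G φ n ≤ errorTerm G ψ n := by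
  obtain ⟨lam, hanti, h⟩ := hφ
  rw [errorTerm_eq hpos htr, errorTerm_eq hpos htr]
  refine sub_le_sub_left ?_ _
  have h1 : ∀ i, (⟪φ i, G (φ i)⟫_ℂ).re = lam i := fun i => by
    rw [re_inner_apply_of_eq_smul (h i), φ.orthonormal.1 i]
    simp
  simp only [h1]
  refine hasSum_le_sum_firstIdx (p := fun i => ∑ k ∈ firstIdx κ n, ‖⟪φ i, ψ k⟫_ℂ‖ ^ 2)
    (m := (firstIdx κ n).card) hanti (eigenvalue_nonneg hpos φ h) (fun i => by positivity)
    (fun i => ?_) (by exact_mod_cast card_firstIdx_le) ?_ ?_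
  · have := ψ.orthonormal.sum_inner_products_le (φ i) (s := firstIdx κ n)
    simpa only [norm_inner_symm (φ i), φ.orthonormal.1 i, one_pow] using this
  · convert hasSum_sum (s := firstIdx κ n) fun k _ => hasSum_norm_inner_sq φ (ψ k)
    simp [ψ.orthonormal.1]
  · simp only [Finset.mul_sum]
    exact hasSum_sum (s := firstIdx κ n) fun k _ => hasSum_eigenvalue_mul hpos φ h (ψ k)

end Minimality

/-! ### Compactness, eigenbasis and well-ordering. -/

section Existence

variable {H : Type u} [NormedAddCommGroup H] [InnerProductSpace ℂ H] [CompleteSpace H]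
  {G : H →L[ℂ] H}

omit [CompleteSpace H] in
theorem isCompactOperator_rankOne (x y : H) :
    IsCompactOperator (InnerProductSpace.rankOne ℂ x y : H →L[ℂ] H) :=
  IsCompactOperator.clm_comp (f := innerSL ℂ y)
    (isCompactOperator_of_locallyCompactSpace_dom (innerSL ℂ y))
    (ContinuousLinearMap.toSpanSingleton ℂ x)

/-- A self-adjoint Hilbert–Schmidt operator is compact. -/
theorem isCompactOperator_of_summable_norm_apply_sq {S : H →L[ℂ] H} (hS : IsSelfAdjoint S)
    {ι : Type*} (b : HilbertBasis ι ℂ H) (h : Summable fun i => ‖S (b i)‖ ^ 2) :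
    IsCompactOperator S := by
  obtain ⟨t, ht⟩ := h
  let T : Finset ι → H →L[ℂ] H := fun F =>
    ∑ i ∈ F, InnerProductSpace.rankOne ℂ (b i) (S (b i))
  have hT : ∀ F, IsCompactOperator (T F) := fun F =>
    Submodule.sum_mem (compactOperator (RingHom.id ℂ) H H) (t := F)
      fun i _ => isCompactOperator_rankOne (b i) (S (b i))
  have hbound : ∀ F, ‖S - T F‖ ≤ √(t - ∑ i ∈ F, ‖S (b i)‖ ^ 2) := fun F => by
    have hnn : 0 ≤ t - ∑ i ∈ F, ‖S (b i)‖ ^ 2 :=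
      sub_nonneg.2 (sum_le_hasSum F (fun _ _ => by positivity) ht)
    refine ContinuousLinearMap.opNorm_le_bound _ (Real.sqrt_nonneg _) fun x => ?_
    refine le_of_sq_le_sq ?_ (by positivity)
    rw [mul_pow, Real.sq_sqrt hnn]
    have h1 : (S - T F) x = S x - ∑ i ∈ F, ⟪b i, S x⟫_ℂ • b i := by
      simp [T, ← hS.isSymmetric.apply_clm]
    rw [h1, norm_sub_sum_sq b.orthonormal]
    -- The differences `‖S (b i)‖ ^ 2 * ‖x‖ ^ 2 - ‖⟪b i, S x⟫‖ ^ 2` are nonnegative by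
    -- Cauchy–Schwarz, so their partial sum over `F` is at most the full sum.
    have h2 := sum_le_hasSum F (fun i _ => sub_nonneg.2 ?_)
      ((ht.mul_right (‖x‖ ^ 2)).sub (hasSum_norm_inner_sq b (S x)))
    · rw [Finset.sum_sub_distrib, ← Finset.sum_mul] at h2
      linarith
    · rw [← hS.isSymmetric.apply_clm, ← mul_pow]
      gcongr
      exact norm_inner_le_norm _ _
  refine isCompactOperator_of_tendsto (l := Filter.atTop) (F := T) ?_ (.of_forall hT)
  rw [tendsto_iff_norm_sub_tendsto_zero]
  have h0 : Filter.Tendsto (fun F => √(t - ∑ i ∈ F, ‖S (b i)‖ ^ 2)) Filter.atTop (nhds 0) := by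
    have h2 : Filter.Tendsto (fun F => ∑ i ∈ F, ‖S (b i)‖ ^ 2) Filter.atTop (nhds t) := ht
    simpa using (h2.const_sub t).sqrt
  exact squeeze_zero (fun _ => norm_nonneg _) (fun F => norm_sub_rev (T F) S ▸ hbound F) h0

theorem isCompactOperator_of_isTraceClass (hpos : G.IsPositive) (htr : IsTraceClass G) :
    IsCompactOperator G := by
  have h := (hasSum_re_inner_apply_trace hpos htr (someONB H)).summable
  obtain ⟨S, hS, rfl⟩ := exists_isSelfAdjoint_comp_self_eq hpos
  simp only [inner_comp_self_apply hS, Complex.ofReal_re] at h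
  exact (isCompactOperator_of_summable_norm_apply_sq hS _ h).comp_clm S

/-- An orthonormal basis of eigenvectors. -/
theorem exists_hilbertBasis_eigenvectors (hpos : G.IsPositive) (hG : IsCompactOperator G) :
    ∃ (J : Type u) (φ : HilbertBasis J ℂ H) (lam : J → ℝ),
      ∀ j, G (φ j) = (lam j : ℂ) • φ j := by
  have hsymm : (G : H →ₗ[ℂ] H).IsSymmetric := hpos.isSelfAdjoint.isSymmetric
  let E : ℂ → Submodule ℂ H := fun μ => Module.End.eigenspace (G : H →ₗ[ℂ] H) μ
  have hE : ∀ μ x, x ∈ E μ ↔ G x = μ • x := fun μ x => Module.End.mem_eigenspace_iff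
  have hcomplete : ∀ μ, CompleteSpace (E μ) := fun μ => by
    have : IsClosed (E μ : Set H) := by
      have h : (E μ : Set H) = {x | G x = μ • x} := Set.ext fun x => hE μ x
      rw [h]
      exact isClosed_eq G.continuous (continuous_const_smul μ)
    exact this.completeSpace_coe
  choose s b _ using fun μ => exists_hilbertBasis ℂ (E μ)
  let v : (Σ μ, s μ) → H := fun p => (b p.1 p.2 : E p.1)
  have hv : Orthonormal ℂ v :=
    hsymm.orthogonalFamily_eigenspaces.orthonormal_sigma_orthonormal fun μ => (b μ).orthonormal
  have hbot : (Submodule.span ℂ (Set.range v))ᗮ = ⊥ := by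
    rw [eq_bot_iff, ← ContinuousLinearMap.orthogonalComplement_iSup_eigenspaces_eq_bot hG hsymm]
    intro x hx
    rw [Submodule.mem_orthogonal'] at hx
    rw [← Submodule.iInf_orthogonal, Submodule.mem_iInf]
    intro μ
    rw [Submodule.mem_orthogonal]
    intro y hy
    -- Expanding `y` in the basis of its eigenspace reduces orthogonality to the vectors `v`.
    have h1 := ((b μ).hasSum_repr ⟨y, hy⟩).mapL (innerSL ℂ x ∘L (E μ).subtypeL)
    rw [← inner_conj_symm, map_eq_zero]
    refine h1.unique ?_
    convert hasSum_zero using 2 with i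
    have h2 : ⟪x, (b μ i : H)⟫_ℂ = 0 := hx _ (Submodule.subset_span ⟨⟨μ, i⟩, rfl⟩)
    simp [h2]
  let φ := HilbertBasis.mkOfOrthogonalEqBot hv hbot
  have hφ : ⇑φ = v := HilbertBasis.coe_mkOfOrthogonalEqBot hv hbot
  have heig : ∀ p, G (φ p) = p.1 • φ p := fun p => by
    rw [hφ]; exact (hE _ _).1 (b p.1 p.2).2
  refine ⟨_, φ, fun p => p.1.re, fun p => ?_⟩
  have hreal : (starRingEnd ℂ) p.1 = p.1 := by
    have h1 := hsymm (φ p) (φ p)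
    simp only [ContinuousLinearMap.coe_coe, heig, inner_smul_left, inner_smul_right] at h1
    rw [inner_self_eq_norm_sq_to_K, φ.orthonormal.1 p] at h1
    simpa using h1
  rw [heig, Complex.conj_eq_iff_re.1 hreal]

/-- A nonnegative summable function on a type is antitone for some well-order. -/
theorem exists_wellOrder_antitone {J : Type u} {lam : J → ℝ} (h0 : ∀ j, 0 ≤ lam j)
    (hs : Summable lam) : ∃ (_ : LinearOrder J) (_ : WellFoundedLT J), Antitone lam := by
  have hfin : ∀ ε > 0, {j | ε ≤ lam j}.Finite := fun ε hε => by
    have := hs.tendsto_cofinite_zero.eventually (gt_mem_nhds hε)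
    simpa [Filter.eventually_cofinite] using this
  have hwf : WellFounded fun x y : Set.range lam => (y : ℝ) < x := by
    rw [WellFounded.wellFounded_iff_has_min]
    intro s hs
    -- Only finitely many values lie above a positive one, so a largest exists; without positive
    -- elements, `s` contains only `0`.
    by_cases hp : ∃ x ∈ s, 0 < (x : ℝ)
    · obtain ⟨x, hx, hx0⟩ := hp
      have hf : {y | y ∈ s ∧ (x : ℝ) ≤ y}.Finite := by
        refine Set.Finite.of_finite_image (f := Subtype.val) (((hfin x hx0).image lam).subset ?_)
          Subtype.val_injective.injOn
        rintro _ ⟨⟨_, j, rfl⟩, ⟨_, h⟩, rfl⟩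
        exact ⟨j, h, rfl⟩
      obtain ⟨m, ⟨hm, hxm⟩, hmax⟩ := hf.exists_maximalFor Subtype.val _ ⟨x, hx, le_rfl⟩
      refine ⟨m, hm, fun y hy hlt => ?_⟩
      exact hlt.not_ge (hmax ⟨hy, hxm.trans hlt.le⟩ hlt.le)
    · push Not at hp
      obtain ⟨x, hx⟩ := hs
      refine ⟨x, hx, fun y hy hlt => ?_⟩
      obtain ⟨j, hj⟩ := x.2
      linarith [hp y hy, h0 j]
  obtain ⟨o, ho⟩ := exists_wellFoundedLT J
  have : WellFoundedLT (Set.range lam)ᵒᵈ := ⟨hwf⟩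
  -- Larger values come first; an arbitrary well-order of `J` breaks ties, which matters when `0` is
  -- attained infinitely often.
  let g : J → (Set.range lam)ᵒᵈ ×ₗ J := fun j => toLex (OrderDual.toDual ⟨lam j, j, rfl⟩, j)
  have hg : Function.Injective g := fun i j h => congrArg (fun p => (ofLex p).2) h
  refine ⟨LinearOrder.lift' g hg, ⟨InvImage.wf g wellFounded_lt⟩, ?_⟩
  intro i j hij
  have h : g i ≤ g j := hij
  rcases Prod.Lex.le_iff.1 h with h | ⟨h, _⟩
  · exact le_of_lt h
  · exact (congrArg (fun x => ((OrderDual.ofDual x : Set.range lam) : ℝ)) h).ge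

theorem exists_isKarhunenLoeve (hpos : G.IsPositive) (htr : IsTraceClass G) :
    ∃ (ι : Type u) (_ : LinearOrder ι) (_ : WellFoundedLT ι) (φ : HilbertBasis ι ℂ H),
      IsKarhunenLoeve G φ := by
  obtain ⟨J, φ, lam, h⟩ :=
    exists_hilbertBasis_eigenvectors hpos (isCompactOperator_of_isTraceClass hpos htr)
  have hs : Summable lam := by
    refine (hasSum_re_inner_apply_trace hpos htr φ).summable.congr fun j => ?_
    rw [re_inner_apply_of_eq_smul (h j), φ.orthonormal.1 j]
    simp
  obtain ⟨o, hwf, hanti⟩ := exists_wellOrder_antitone (eigenvalue_nonneg hpos φ h) hs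
  exact ⟨J, o, hwf, φ, lam, hanti, h⟩

end Existence

end KarhunenLoeve

end

theorem theorem4p8 {H : Type u} [NormedAddCommGroup H] [InnerProductSpace ℂ H]
    [CompleteSpace H] (G : H →L[ℂ] H) (hpos : G.IsPositive)
    (htr : KarhunenLoeve.IsTraceClass G) :
    -- a Karhunen–Loève basis exists
    (∃ (ι : Type u) (_ : LinearOrder ι) (_ : WellFoundedLT ι) (φ : HilbertBasis ι ℂ H),
      KarhunenLoeve.IsKarhunenLoeve G φ) ∧
    -- it has the smallest error terms among all orthonormal bases
    (∀ {ι : Type v₁} [LinearOrder ι] [WellFoundedLT ι] (φ : HilbertBasis ι ℂ H),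
      KarhunenLoeve.IsKarhunenLoeve G φ → ∀ n : ℕ,
        (∀ {κ : Type v₂} [LinearOrder κ] [WellFoundedLT κ] (ψ : HilbertBasis κ ℂ H),
          KarhunenLoeve.errorTerm G φ n ≤ KarhunenLoeve.errorTerm G ψ n) ∧
        IsLeast (Set.range fun ψ : HilbertBasis ι ℂ H => KarhunenLoeve.errorTerm G ψ n)
          (KarhunenLoeve.errorTerm G φ n)) ∧
    (∀ {κ : Type v₂} [LinearOrder κ] [WellFoundedLT κ] (ψ : HilbertBasis κ ℂ H) (n : ℕ),
      -- the trace defining the error term converges, to the same real value, in every basis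
      (∀ {J : Type v₃} (b : HilbertBasis J ℂ H),
        HasSum (fun j => ⟪b j, (G ∘L (ContinuousLinearMap.id ℂ H - KarhunenLoeve.Q ψ n)) (b j)⟫_ℂ)
          (KarhunenLoeve.errorTerm G ψ n : ℂ)) ∧
      -- it is the weighted square error in approximating the frame vectors
      (∀ {A : Type v₄} (w : A → ℝ) (f : A → H), KarhunenLoeve.IsFrameOperator w f G →
        HasSum (fun α =>
            w α * ‖f α - ∑ i ∈ KarhunenLoeve.firstIdx κ n, ⟪ψ i, f α⟫_ℂ • ψ i‖ ^ 2)
          (KarhunenLoeve.errorTerm G ψ n))) := by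
  refine ⟨KarhunenLoeve.exists_isKarhunenLoeve hpos htr, fun φ hφ n => ⟨fun ψ =>
    KarhunenLoeve.errorTerm_le_errorTerm hpos htr hφ ψ n, ⟨φ, rfl⟩, ?_⟩, fun ψ n =>
    ⟨fun b => KarhunenLoeve.hasSum_errorTerm hpos htr ψ n b, fun w f hf =>
      hf.hasSum_errorTerm hpos htr ψ n⟩⟩
  rintro _ ⟨ψ, rfl⟩
  exact KarhunenLoeve.errorTerm_le_errorTerm hpos htr hφ ψ n
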